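/- Let $p\in\mathbb C[z]$ be a polynomial of degree $d\ge 2$ all of whose roots are simple, and let $\delta\in\mathbb C\setminus\{0\}$. Let $N_p(z)=z-p(z)/p'(z)$ and let $T_{p,\delta}(z)=N_p(z)-\delta\,\dfrac{p(N_p(z))}{p'(z)}$, a rational map of the Riemann sphere $\hat{\mathbb C}$. Write $\delta_*=d^d/(d-1)^{d-1}$. The multiplicity of $x\in\hat{\mathbb C}$ as a critical point is the local degree of $T_{p,\delta}$ at $x$ minus one; $x$ is critical if this is at least $1$. For a polynomial $q\neq 0$ let $\operatorname{ord}_z q$ be the order of vanishing of $q$ at $z$. For $p'(z)\ne 0$ put $$B(z)=p(z)-\delta\,\frac{p'(N_p(z))\,p(z)}{p'(z)}+\delta\,p(N_p(z)).$$ The map $T_{p,\delta}$ has degree $d^2$ if $\delta\ne\delta_*$ and $d^2-1$ if $\delta=\delta_*$. It has finitely many critical points, and they are classified as follows. (a) Every zero $\alpha$ of $p$ is a critical point. Its multiplicity is $1+\operatorname{ord}_\alpha p''$ if $\delta\neq 1$ and $2(1+\operatorname{ord}_\alpha p'')$ if $\delta=1$. In particular, if $p''(\alpha)\ne0$, it is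 $1$ for $\delta\ne1$ and $2$ for $\delta=1$. (b) Every zero $\beta$ of $p'$ is a pole of $T_{p,\delta}$ and a critical point, of multiplicity $d\cdot\operatorname{ord}_\beta p'+\operatorname{ord}_\beta p''$. In particular, the multiplicity is $d$ if $\beta$ is a simple zero of $p'$. (c) Every zero $\gamma$ of $p''$ is a critical point, of multiplicity at least $\operatorname{ord}_\gamma p''$. If $p(\gamma)\ne 0$ and $p'(\gamma)\neq 0$, then the multiplicity equals $\operatorname{ord}_\gamma p''$ if and only if $B(\gamma)\neq 0$. (d) Put $\varepsilon=2$ if $\delta=1$ and $\varepsilon=1$ otherwise. The zeros of $p$, $p'$ and $p''$ account at each $z\in\mathbb C$ for the multiplicity $\varepsilon\operatorname{ord}_z p+d\operatorname{ord}_z p'+\operatorname{ord}_z p''$, and at $\infty$ for $0$. At every point of $\hat{\mathbb C}$ this is at most the multiplicity of that point as a critical point of $T_{p,\delta}$. The total multiplicity in $\hat{\mathbb C}$ that is not accounted for in this way (the number of remaining critical points) is (i) $d(d-1)$ if $\delta\ne1$ and $\delta\neq\delta_*$; (ii) $d(d-2)$ if $\delta=1$; (iii) $d(d-1)-2$ if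 $\delta=\delta_*$. The number of critical points in $\hat{\mathbb C}$, counted with multiplicity, that are zeros of none of $p$, $p'$, $p''$ is at most the number in (i)–(iii). The two are equal if and only if every $\gamma$ with $p''(\gamma)=0\neq p'(\gamma)$ satisfies $\delta\ne1$ in case $p(\gamma)=0$, and $B(\gamma)\ne0$ in case $p(\gamma)\neq0$. -/

import Mathlib

open Polynomial

noncomputable section

namespace DampedTraub

/-! ### Rational functions as self-maps of the Riemann sphere `OnePoint ℂ` -/

/-- The value of the rational function `f` at a point of the Riemann sphere. -/
def value (f : RatFunc ℂ) : OnePoint ℂ → OnePoint ℂ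
  | some z =>
      if f.denom.eval z = 0 then OnePoint.infty
      else ((f.num.eval z / f.denom.eval z : ℂ) : OnePoint ℂ)
  | none =>
      if f.denom.natDegree < f.num.natDegree then OnePoint.infty
      else ((f.num.coeff f.denom.natDegree / f.denom.leadingCoeff : ℂ) : OnePoint ℂ)

/-- The order of vanishing of a nonzero rational function `f` at a point of the Riemann sphere
(negative at the poles). -/
def ord (f : RatFunc ℂ) : OnePoint ℂ → ℤ
  | some z => (f.num.rootMultiplicity z : ℤ) - (f.denom.rootMultiplicity z : ℤ)
  | none => (f.denom.natDegree : ℤ) - (f.num.natDegree : ℤ)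

/-- The local degree of a nonconstant rational map `f` at `x`: the multiplicity with which `f`
takes the value `f x` at `x`. At a pole it is the order of the pole; elsewhere it is the
order of vanishing of `f - f x` at `x`. -/
def localDegree (f : RatFunc ℂ) (x : OnePoint ℂ) : ℕ :=
  match value f x with
  | some w => (ord (f - RatFunc.C w) x).toNat
  | none => (-ord f x).toNat

/-- The multiplicity of `x` as a critical point of a nonconstant rational map `f`: the local
degree minus one. It is `0` when `x` is not critical. -/
def critMult (f : RatFunc ℂ) (x : OnePoint ℂ) : ℕ :=
  localDegree f x - 1

/-- `x` is a critical point of `f`: the map `f` is not locally injective at `x`. -/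
def IsCritical (f : RatFunc ℂ) (x : OnePoint ℂ) : Prop :=
  2 ≤ localDegree f x

/-- The degree of a rational map. -/
def degree (f : RatFunc ℂ) : ℕ :=
  max f.num.natDegree f.denom.natDegree

/-! ### Newton's map and the damped Traub maps -/

/-- Newton's map `N_p = z - p / p'`. -/
def newton (p : ℂ[X]) : RatFunc ℂ :=
  RatFunc.X - algebraMap ℂ[X] (RatFunc ℂ) p / algebraMap ℂ[X] (RatFunc ℂ) (derivative p)

/-- The damped Traub map `T_{p,δ} = N_p - δ p(N_p) / p'`. -/
def traub (p : ℂ[X]) (δ : ℂ) : RatFunc ℂ :=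
  newton p -
    RatFunc.C δ * (aeval (newton p) p / algebraMap ℂ[X] (RatFunc ℂ) (derivative p))

/-- The degeneracy parameter `d ^ d / (d - 1) ^ (d - 1)`. -/
def degenerateParam (d : ℕ) : ℂ :=
  (d : ℂ) ^ d / ((d : ℂ) - 1) ^ (d - 1)

/-! ### Counting the critical points -/

/-- The critical multiplicity accounted for by the zeros of `p`, `p'` and `p''`:
each zero of `p` contributes `1` (`2` if `δ = 1`), each zero of `p'` contributes `degree p` and
each zero of `p''` contributes `1`, all zeros repeated according to multiplicity. -/
def accountedMult (p : ℂ[X]) (δ : ℂ) : OnePoint ℂ → ℕ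
  | some z =>
      (if δ = 1 then 2 else 1) * p.rootMultiplicity z
        + p.natDegree * (derivative p).rootMultiplicity z
        + (derivative (derivative p)).rootMultiplicity z
  | none => 0

/-- The number of critical points of `T_{p,δ}` on the sphere, with multiplicity, that are left
after the contributions of the zeros of `p`, `p'` and `p''` are removed. -/
def remainingCount (p : ℂ[X]) (δ : ℂ) : ℕ :=
  ∑ᶠ x : OnePoint ℂ, (critMult (traub p δ) x - accountedMult p δ x)

/-- The points of the sphere that are zeros of none of `p`, `p'`, `p''`. -/
def otherPoints (p : ℂ[X]) : Set (OnePoint ℂ) :=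
  {x | ∀ z : ℂ, x = (z : OnePoint ℂ) →
    p.eval z ≠ 0 ∧ (derivative p).eval z ≠ 0 ∧ (derivative (derivative p)).eval z ≠ 0}

/-- The number, with multiplicity, of critical points of `T_{p,δ}` on the sphere that are
zeros of none of `p`, `p'`, `p''`. -/
def otherCount (p : ℂ[X]) (δ : ℂ) : ℕ :=
  ∑ᶠ x ∈ otherPoints p, critMult (traub p δ) x

/-- The number `p(z) - δ p'(w) p(z) / p'(z) + δ p(w)`, where `w = z - p(z) / p'(z)`. -/
def bracket (p : ℂ[X]) (δ z : ℂ) : ℂ :=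
  p.eval z
    - δ * ((derivative p).eval (z - p.eval z / (derivative p).eval z) * p.eval z
        / (derivative p).eval z)
    + δ * p.eval (z - p.eval z / (derivative p).eval z)

end DampedTraub

end

noncomputable section

namespace DampedTraub

/-! ### Orders of vanishing of polynomials -/

/-! Since `N_p' = p p'' / p'^2`, differentiating gives `T' = p'' B / p'^2`. The critical points thus
come from `p'`, `p''` and `B`, and the work is to make this exact at poles, at zeros of `p` and at
infinity.

Write `T = A / p'^(d+1)` with `A = traubNum p δ`. At a zero of `p'` simplicity of the roots gives `p
≠ 0`, hence `A ≠ 0`, so the fraction is reduced. Its Wronskian is `p'^d p'' · critPoly`, where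
`critPoly = p'^d B` is a polynomial not vanishing at zeros of `p'` (`wronskian_traubNum`,
`critPoly_eval_ne_zero`). Off the poles the local degree is one plus the order of the Wronskian; a
direct count at the poles gives the same formula. So at every finite point the critical multiplicity
is `d ord p' + ord p'' + ord critPoly` (`localDegree_traub`).

At a zero `α` of `p`, the order of `critPoly` is found by factoring the numerator of `T - α`
(`rootMultiplicity_critPoly_of_root`). It is at least `1`, or `2` if `δ = 1`, so the excess over the
accounted multiplicity is never negative. Summed over the sphere, the excess is `critMult ∞ + deg
critPoly - ε d`.

The coefficients of `A` and `critPoly` in degree `d^2` are nonzero multiples of `d^d - δ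
(d-1)^(d-1)`. If this is nonzero, infinity is a simple pole and `deg critPoly = d^2`. If it
vanishes, the degree of the Wronskian yields `critMult ∞ + deg critPoly = d^2 - 2`. The number of
other critical points falls short of the count exactly by the excess at the zeros of `p`, `p'`,
`p''`. -/

lemma rootMultiplicity_add_eq_left {f g : ℂ[X]} {z : ℂ} (hf : f ≠ 0)
    (hg : (X - C z) ^ (f.rootMultiplicity z + 1) ∣ g) :
    (f + g).rootMultiplicity z = f.rootMultiplicity z := by
  have hnot : ¬ (X - C z) ^ (f.rootMultiplicity z + 1) ∣ f + g := by
    intro h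
    have h1 := (dvd_add_left hg).1 h
    have := (le_rootMultiplicity_iff hf).2 h1
    omega
  have hne : f + g ≠ 0 := by
    intro h
    exact hnot (h ▸ dvd_zero _)
  apply le_antisymm
  · by_contra! h
    exact hnot ((le_rootMultiplicity_iff hne).1 h)
  · rw [le_rootMultiplicity_iff hne]
    exact dvd_add (pow_rootMultiplicity_dvd f z) ((pow_dvd_pow _ (Nat.le_succ _)).trans hg)

lemma rootMultiplicity_eq_zero_of_eval_ne {f : ℂ[X]} {z : ℂ} (h : f.eval z ≠ 0) :
    f.rootMultiplicity z = 0 :=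
  rootMultiplicity_eq_zero h

lemma rootMultiplicity_pos_of_eval_eq {f : ℂ[X]} {z : ℂ} (hf : f ≠ 0) (h : f.eval z = 0) :
    0 < f.rootMultiplicity z :=
  (rootMultiplicity_pos hf).2 h

lemma rootMultiplicity_eq_derivative_add_one {f : ℂ[X]} {z : ℂ} (hf : f ≠ 0)
    (h : f.eval z = 0) :
    f.rootMultiplicity z = (derivative f).rootMultiplicity z + 1 := by
  have h1 := derivative_rootMultiplicity_of_root (p := f) (t := z) h
  have := rootMultiplicity_pos_of_eval_eq hf h
  omega

/-- Differentiation lowers the order of `P` by one, while `P * Q'` keeps at least the order of `P`,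
so `P' * Q` dominates. -/
lemma rootMultiplicity_wronskian {P Q : ℂ[X]} {z : ℂ} (hP : P ≠ 0) (hz : P.eval z = 0)
    (hQ : Q.eval z ≠ 0) :
    (derivative P * Q - P * derivative Q).rootMultiplicity z + 1 = P.rootMultiplicity z := by
  have h1 := rootMultiplicity_eq_derivative_add_one hP hz
  have hQ0 : Q ≠ 0 := by rintro rfl; simp at hQ
  have hd : derivative P ≠ 0 := by
    intro h
    have h2 : P.natDegree = 0 := derivative_eq_zero.1 h
    rw [eq_C_of_natDegree_eq_zero h2] at hz hP
    simp at hz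
    simp [hz] at hP
  have h3 : (derivative P * Q).rootMultiplicity z = (derivative P).rootMultiplicity z := by
    rw [rootMultiplicity_mul (mul_ne_zero hd hQ0), rootMultiplicity_eq_zero_of_eval_ne hQ,
      add_zero]
  rw [sub_eq_add_neg, rootMultiplicity_add_eq_left (mul_ne_zero hd hQ0), h3, h1]
  rw [h3, ← h1]
  exact ((pow_rootMultiplicity_dvd P z).mul_right _).neg_right

/-- The top coefficient is `deg P - deg Q` times the product of the leading coefficients; it
survives because the degrees differ. -/
lemma natDegree_wronskian_add_one {P Q : ℂ[X]} (hP : P ≠ 0) (h : P.natDegree < Q.natDegree) :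
    (derivative P * Q - P * derivative Q).natDegree + 1 = P.natDegree + Q.natDegree := by
  obtain ⟨m, hm⟩ : ∃ m, Q.natDegree = m + 1 := ⟨Q.natDegree - 1, by omega⟩
  have hQ : Q ≠ 0 := by rintro rfl; simp at hm
  have hcQ : (P * derivative Q).coeff (P.natDegree + m) =
      P.leadingCoeff * (Q.leadingCoeff * (m + 1)) := by
    rw [coeff_mul_add_eq_of_natDegree_le le_rfl
      ((natDegree_derivative_le Q).trans (by omega)), coeff_derivative, leadingCoeff,
      leadingCoeff, hm]
  have hcP : (derivative P * Q).coeff (P.natDegree + m) =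
      P.natDegree * P.leadingCoeff * Q.leadingCoeff := by
    rcases Nat.eq_zero_or_pos P.natDegree with h0 | h0
    · rw [eq_C_of_natDegree_eq_zero h0]; simp
    · obtain ⟨k, hk⟩ : ∃ k, P.natDegree = k + 1 := ⟨P.natDegree - 1, by omega⟩
      rw [show P.natDegree + m = k + (m + 1) by omega,
        coeff_mul_add_eq_of_natDegree_le ((natDegree_derivative_le P).trans (by omega)) hm.le,
        coeff_derivative, leadingCoeff, leadingCoeff, hm, hk]
      push_cast; ring
  have hc : (derivative P * Q - P * derivative Q).coeff (P.natDegree + m) ≠ 0 := by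
    rw [coeff_sub, hcP, hcQ]
    have : (P.natDegree : ℂ) - (m + 1) ≠ 0 := by
      rw [sub_ne_zero]; norm_cast; omega
    have h2 := mul_ne_zero this
      (mul_ne_zero (leadingCoeff_ne_zero.2 hP) (leadingCoeff_ne_zero.2 hQ))
    intro h3
    exact h2 (by linear_combination h3)
  have hle : (derivative P * Q - P * derivative Q).natDegree ≤ P.natDegree + m := by
    refine (natDegree_sub_le _ _).trans (max_le ?_ ?_)
    · rcases Nat.eq_zero_or_pos P.natDegree with h0 | h0
      · rw [eq_C_of_natDegree_eq_zero h0]; simp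
      · refine natDegree_mul_le.trans ?_
        have := natDegree_derivative_le P
        omega
    · refine natDegree_mul_le.trans ?_
      have := natDegree_derivative_le Q
      omega
  rw [natDegree_eq_of_le_of_coeff_ne_zero hle hc]
  omega

/-! ### Local data of a quotient of coprime polynomials -/

section Quotient

variable {P Q : ℂ[X]}

/-- The rational function `P / Q`. -/
abbrev quot (P Q : ℂ[X]) : RatFunc ℂ :=
  algebraMap ℂ[X] (RatFunc ℂ) P / algebraMap ℂ[X] (RatFunc ℂ) Q

lemma num_mul_eq_mul_denom (hQ : Q ≠ 0) : (quot P Q).num * Q = P * (quot P Q).denom :=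
  (RatFunc.num_mul_eq_mul_denom_iff hQ).2 rfl

lemma quot_ne_zero (hP : P ≠ 0) (hQ : Q ≠ 0) : quot P Q ≠ 0 :=
  div_ne_zero (RatFunc.algebraMap_ne_zero hP) (RatFunc.algebraMap_ne_zero hQ)

lemma ord_quot_coe (hP : P ≠ 0) (hQ : Q ≠ 0) (z : ℂ) :
    ord (quot P Q) (z : OnePoint ℂ) = (P.rootMultiplicity z : ℤ) - Q.rootMultiplicity z := by
  have hn := RatFunc.num_ne_zero (quot_ne_zero hP hQ)
  have hd := RatFunc.denom_ne_zero (quot P Q)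
  have h := congrArg (rootMultiplicity z) (num_mul_eq_mul_denom (P := P) hQ)
  rw [rootMultiplicity_mul (mul_ne_zero hn hQ), rootMultiplicity_mul (mul_ne_zero hP hd)] at h
  change ((quot P Q).num.rootMultiplicity z : ℤ) - ((quot P Q).denom.rootMultiplicity z : ℤ) = _
  omega

lemma ord_quot_infty (hP : P ≠ 0) (hQ : Q ≠ 0) :
    ord (quot P Q) OnePoint.infty = (Q.natDegree : ℤ) - P.natDegree := by
  have hn := RatFunc.num_ne_zero (quot_ne_zero hP hQ)
  have hd := RatFunc.denom_ne_zero (quot P Q)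
  have h := congrArg natDegree (num_mul_eq_mul_denom (P := P) hQ)
  rw [natDegree_mul hn hQ, natDegree_mul hP hd] at h
  change ((quot P Q).denom.natDegree : ℤ) - ((quot P Q).num.natDegree : ℤ) = _
  omega

lemma quot_sub_C (hQ : Q ≠ 0) (w : ℂ) : quot P Q - RatFunc.C w = quot (P - C w * Q) Q := by
  have h := RatFunc.algebraMap_ne_zero hQ
  rw [quot, quot, map_sub, map_mul, sub_div, mul_div_cancel_right₀ _ h, RatFunc.algebraMap_C]

lemma denom_eval_eq_zero_iff (hPQ : IsCoprime P Q) (hQ : Q ≠ 0) (z : ℂ) :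
    (quot P Q).denom.eval z = 0 ↔ Q.eval z = 0 := by
  have h := congrArg (eval z) (num_mul_eq_mul_denom (P := P) hQ)
  obtain ⟨a, b, hab⟩ := RatFunc.isCoprime_num_denom (quot P Q)
  obtain ⟨a', b', hab'⟩ := hPQ
  have h1 := congrArg (eval z) hab
  have h2 := congrArg (eval z) hab'
  simp only [eval_add, eval_mul, eval_one] at h h1 h2
  constructor
  · intro h0
    rw [h0, mul_zero] at h
    rcases mul_eq_zero.1 h with h | h
    · rw [h, h0, mul_zero, mul_zero, add_zero] at h1
      exact absurd h1 zero_ne_one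
    · exact h
  · intro h0
    rw [h0, mul_zero] at h
    rcases mul_eq_zero.1 h.symm with h | h
    · simp [h, h0] at h2
    · exact h

lemma value_quot_of_eval_eq_zero (hPQ : IsCoprime P Q) (hQ : Q ≠ 0) {z : ℂ}
    (hz : Q.eval z = 0) : value (quot P Q) (z : OnePoint ℂ) = OnePoint.infty :=
  if_pos ((denom_eval_eq_zero_iff hPQ hQ z).2 hz)

lemma value_quot_of_eval_ne_zero (hPQ : IsCoprime P Q) {z : ℂ} (hz : Q.eval z ≠ 0) :
    value (quot P Q) (z : OnePoint ℂ) = ((P.eval z / Q.eval z : ℂ) : OnePoint ℂ) := by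
  have hQ : Q ≠ 0 := by rintro rfl; simp at hz
  have hd : (quot P Q).denom.eval z ≠ 0 := fun h ↦ hz ((denom_eval_eq_zero_iff hPQ hQ z).1 h)
  have h := congrArg (eval z) (num_mul_eq_mul_denom (P := P) hQ)
  simp only [eval_mul] at h
  refine (if_neg hd).trans ?_
  rw [(div_eq_div_iff hd hz).2 h]

/-- The cofactor of the reduced denominator in `Q` also divides `P`, so coprimality makes it a unit.
Degrees and values can then be read off `P` and `Q` themselves. -/
lemma exists_eq_C_mul_num_denom (hPQ : IsCoprime P Q) (hQ : Q ≠ 0) :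
    ∃ c : ℂ, c ≠ 0 ∧ P = C c * (quot P Q).num ∧ Q = C c * (quot P Q).denom := by
  have h := num_mul_eq_mul_denom (P := P) hQ
  obtain ⟨g, hg⟩ : (quot P Q).denom ∣ Q := RatFunc.denom_div_dvd P Q
  have hd := RatFunc.denom_ne_zero (quot P Q)
  have hP' : P = g * (quot P Q).num := by
    apply mul_right_cancel₀ hd
    rw [← h]
    nth_rw 2 [hg]
    ring
  have hu : IsUnit g := hPQ.isUnit_of_dvd' (Dvd.intro _ hP'.symm) (Dvd.intro_left _ hg.symm)
  obtain ⟨c, hc, rfl⟩ := Polynomial.isUnit_iff.1 hu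
  exact ⟨c, hc.ne_zero, hP', by rw [mul_comm]; exact hg⟩

lemma natDegree_num_denom (hPQ : IsCoprime P Q) (hQ : Q ≠ 0) :
    (quot P Q).num.natDegree = P.natDegree ∧ (quot P Q).denom.natDegree = Q.natDegree := by
  obtain ⟨c, hc, h1, h2⟩ := exists_eq_C_mul_num_denom hPQ hQ
  exact ⟨((congrArg natDegree h1).trans (natDegree_C_mul hc)).symm,
    ((congrArg natDegree h2).trans (natDegree_C_mul hc)).symm⟩

lemma degree_quot (hPQ : IsCoprime P Q) (hQ : Q ≠ 0) :
    degree (quot P Q) = max P.natDegree Q.natDegree := by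
  rw [degree, (natDegree_num_denom hPQ hQ).1, (natDegree_num_denom hPQ hQ).2]

lemma value_quot_infty_of_lt (hPQ : IsCoprime P Q) (hQ : Q ≠ 0)
    (h : Q.natDegree < P.natDegree) :
    value (quot P Q) OnePoint.infty = OnePoint.infty := by
  obtain ⟨h1, h2⟩ := natDegree_num_denom hPQ hQ
  exact if_pos (by rwa [h1, h2])

lemma value_quot_infty_of_le (hPQ : IsCoprime P Q) (hQ : Q ≠ 0)
    (h : P.natDegree ≤ Q.natDegree) :
    value (quot P Q) OnePoint.infty =
      ((P.coeff Q.natDegree / Q.leadingCoeff : ℂ) : OnePoint ℂ) := by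
  obtain ⟨h1, h2⟩ := natDegree_num_denom hPQ hQ
  obtain ⟨c, hc, h3, h4⟩ := exists_eq_C_mul_num_denom hPQ hQ
  have h5 : P.coeff Q.natDegree = c * (quot P Q).num.coeff Q.natDegree :=
    (congrArg (fun f ↦ f.coeff Q.natDegree) h3).trans (coeff_C_mul _)
  have h6 : Q.leadingCoeff = c * (quot P Q).denom.leadingCoeff :=
    (congrArg leadingCoeff h4).trans (by rw [leadingCoeff_mul, leadingCoeff_C])
  refine (if_neg (by rw [h1, h2]; omega)).trans ?_
  rw [h5, h6, mul_div_mul_left _ _ hc, h2]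

lemma localDegree_quot_pole (hPQ : IsCoprime P Q) (hP : P ≠ 0) (hQ : Q ≠ 0) {z : ℂ}
    (hz : Q.eval z = 0) :
    localDegree (quot P Q) (z : OnePoint ℂ) = Q.rootMultiplicity z := by
  have hPz : P.eval z ≠ 0 := by
    intro h
    obtain ⟨a, b, hab⟩ := hPQ
    simpa [h, hz] using congrArg (eval z) hab
  have h := ord_quot_coe hP hQ z
  rw [localDegree, value_quot_of_eval_eq_zero hPQ hQ hz]
  change (-ord (quot P Q) (z : OnePoint ℂ)).toNat = _
  rw [h, rootMultiplicity_eq_zero_of_eval_ne hPz]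
  simp

lemma localDegree_quot_of_eval_ne_zero (hPQ : IsCoprime P Q) {z : ℂ}
    (hz : Q.eval z ≠ 0) (h0 : P - C (P.eval z / Q.eval z) * Q ≠ 0) :
    localDegree (quot P Q) (z : OnePoint ℂ) =
      (P - C (P.eval z / Q.eval z) * Q).rootMultiplicity z := by
  have hQ : Q ≠ 0 := by rintro rfl; simp at hz
  rw [localDegree, value_quot_of_eval_ne_zero hPQ hz]
  change (ord (quot P Q - RatFunc.C (P.eval z / Q.eval z)) (z : OnePoint ℂ)).toNat = _
  rw [quot_sub_C hQ, ord_quot_coe h0 hQ, rootMultiplicity_eq_zero_of_eval_ne hz]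
  simp

lemma localDegree_quot_infty_of_lt (hPQ : IsCoprime P Q) (hP : P ≠ 0) (hQ : Q ≠ 0)
    (h : Q.natDegree < P.natDegree) :
    localDegree (quot P Q) OnePoint.infty = P.natDegree - Q.natDegree := by
  rw [localDegree, value_quot_infty_of_lt hPQ hQ h]
  change (-ord (quot P Q) OnePoint.infty).toNat = _
  rw [ord_quot_infty hP hQ]
  omega

lemma localDegree_quot_infty_of_le (hPQ : IsCoprime P Q) (hQ : Q ≠ 0)
    (h : P.natDegree ≤ Q.natDegree)
    (h0 : P - C (P.coeff Q.natDegree / Q.leadingCoeff) * Q ≠ 0) :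
    localDegree (quot P Q) OnePoint.infty =
      Q.natDegree - (P - C (P.coeff Q.natDegree / Q.leadingCoeff) * Q).natDegree := by
  rw [localDegree, value_quot_infty_of_le hPQ hQ h]
  change (ord (quot P Q - RatFunc.C (P.coeff Q.natDegree / Q.leadingCoeff))
    OnePoint.infty).toNat = _
  rw [quot_sub_C hQ, ord_quot_infty h0 hQ]
  omega

/-- Invariance under `P ↦ P - w Q` allows the value at the point under study to be moved to `0`. -/
lemma wronskian_sub_C_mul (w : ℂ) :
    derivative (P - C w * Q) * Q - (P - C w * Q) * derivative Q =
      derivative P * Q - P * derivative Q := by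
  simp only [derivative_sub, derivative_mul, derivative_C]
  ring

lemma sub_C_mul_ne_zero (hW : derivative P * Q - P * derivative Q ≠ 0) (w : ℂ) :
    P - C w * Q ≠ 0 := by
  intro h
  rw [← wronskian_sub_C_mul w, h] at hW
  simp at hW

lemma localDegree_quot_eq_wronskian (hPQ : IsCoprime P Q)
    (hW : derivative P * Q - P * derivative Q ≠ 0) {z : ℂ} (hz : Q.eval z ≠ 0) :
    localDegree (quot P Q) (z : OnePoint ℂ) =
      (derivative P * Q - P * derivative Q).rootMultiplicity z + 1 := by
  have h0 := sub_C_mul_ne_zero hW (P.eval z / Q.eval z)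
  rw [localDegree_quot_of_eval_ne_zero hPQ hz h0, ← rootMultiplicity_wronskian h0 _ hz,
    wronskian_sub_C_mul]
  simp [hz]

/-- With `w` the value at infinity, `P - w Q` has degree below `deg Q`, and the drop is the local
degree. The Wronskian is unchanged and its degree determines `deg (P - w Q)`. -/
lemma localDegree_quot_infty_add (hPQ : IsCoprime P Q)
    (h : P.natDegree ≤ Q.natDegree) (hQ : 0 < Q.natDegree)
    (hW : derivative P * Q - P * derivative Q ≠ 0) :
    0 < localDegree (quot P Q) OnePoint.infty ∧
    localDegree (quot P Q) OnePoint.infty + (derivative P * Q - P * derivative Q).natDegree + 1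
      = 2 * Q.natDegree := by
  have hQ0 : Q ≠ 0 := by rintro rfl; simp at hQ
  set w := P.coeff Q.natDegree / Q.leadingCoeff with hw
  have h0 := sub_C_mul_ne_zero hW w
  have hle : (P - C w * Q).natDegree ≤ Q.natDegree :=
    (natDegree_sub_le _ _).trans (max_le h (natDegree_C_mul_le _ _))
  have hlt : (P - C w * Q).natDegree < Q.natDegree := by
    refine lt_of_le_of_ne hle fun he ↦ leadingCoeff_ne_zero.2 h0 ?_
    rw [leadingCoeff, he, coeff_sub, coeff_C_mul, coeff_natDegree, hw,
      div_mul_cancel₀ _ (leadingCoeff_ne_zero.2 hQ0), sub_self]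
  have h1 := natDegree_wronskian_add_one h0 hlt
  rw [wronskian_sub_C_mul] at h1
  have h2 := localDegree_quot_infty_of_le hPQ hQ0 h h0
  rw [← hw] at h2
  omega

end Quotient

/-! ### Homogenised evaluation -/

/-- The polynomial `b ^ n * f (a / b)`, for `f` of degree at most `n`. -/
def homogEval (a b : ℂ[X]) (n : ℕ) (f : ℂ[X]) : ℂ[X] :=
  ∑ i ∈ Finset.range (n + 1), C (f.coeff i) * a ^ i * b ^ (n - i)

section HomogEval

variable {a b f g : ℂ[X]} {n k : ℕ}

lemma homogEval_add : homogEval a b n (f + g) = homogEval a b n f + homogEval a b n g := by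
  simp only [homogEval, coeff_add, C_add, add_mul, Finset.sum_add_distrib]

lemma homogEval_C (c : ℂ) : homogEval a b n (C c) = C c * b ^ n := by
  rw [homogEval, Finset.sum_range_succ']
  simp [coeff_C]

lemma algebraMap_homogEval (hb : b ≠ 0) (hf : f.natDegree ≤ n) :
    algebraMap ℂ[X] (RatFunc ℂ) (homogEval a b n f) =
      algebraMap ℂ[X] (RatFunc ℂ) b ^ n * aeval (quot a b) f := by
  have hb' := RatFunc.algebraMap_ne_zero hb
  rw [aeval_eq_sum_range' (Nat.lt_succ_of_le hf), homogEval, map_sum, Finset.mul_sum]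
  refine Finset.sum_congr rfl fun i hi ↦ ?_
  have hi' : i ≤ n := Nat.lt_succ_iff.1 (Finset.mem_range.1 hi)
  rw [map_mul, map_mul, map_pow, map_pow, RatFunc.algebraMap_C, Algebra.smul_def,
    RatFunc.algebraMap_eq_C, quot, div_pow, ← Nat.sub_add_cancel hi', pow_add]
  field_simp
  simp

/-- Homogenisation is multiplicative; this case extracts a root of `p` from the homogenised
`p(N_p)`. -/
lemma homogEval_mul_linear (hb : b ≠ 0) (hg : g.natDegree ≤ n) (c : ℂ) :
    homogEval a b (n + 1) ((X - C c) * g) = (a - C c * b) * homogEval a b n g := by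
  have hb' := RatFunc.algebraMap_ne_zero hb
  apply RatFunc.algebraMap_injective ℂ
  rw [map_mul, algebraMap_homogEval hb, algebraMap_homogEval hb hg, map_mul, map_sub, map_sub,
    aeval_X, aeval_C, map_mul, RatFunc.algebraMap_eq_C, RatFunc.algebraMap_C, quot]
  · field_simp
    ring
  · refine natDegree_mul_le.trans ?_
    rw [natDegree_X_sub_C]
    omega

lemma eval_homogEval_of_ne_zero {z : ℂ} (hb : b.eval z ≠ 0) (hf : f.natDegree ≤ n) :
    (homogEval a b n f).eval z = b.eval z ^ n * f.eval (a.eval z / b.eval z) := by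
  rw [eval_eq_sum_range' (Nat.lt_succ_of_le hf), homogEval, eval_finsetSum, Finset.mul_sum]
  refine Finset.sum_congr rfl fun i hi ↦ ?_
  have hi' : i ≤ n := Nat.lt_succ_iff.1 (Finset.mem_range.1 hi)
  obtain ⟨j, rfl⟩ := Nat.exists_eq_add_of_le hi'
  simp only [eval_mul, eval_pow, eval_C, div_pow, Nat.add_sub_cancel_left, pow_add]
  field_simp

lemma eval_homogEval_of_eq_zero {z : ℂ} (hb : b.eval z = 0) :
    (homogEval a b n f).eval z = f.coeff n * a.eval z ^ n := by
  rw [homogEval, eval_finsetSum, Finset.sum_range_succ, Finset.sum_eq_zero]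
  · simp
  · intro i hi
    have : n - i ≠ 0 := by have := Finset.mem_range.1 hi; omega
    simp [hb, this]

lemma natDegree_homogEval_term (ha : a.natDegree ≤ k + 1) (hb : b.natDegree ≤ k) (c : ℂ)
    {i : ℕ} (hi : i ≤ n) : (C c * a ^ i * b ^ (n - i)).natDegree ≤ n * k + i := by
  have h1 := natDegree_pow_le_of_le i ha
  have h2 := natDegree_pow_le_of_le (n - i) hb
  have h3 := natDegree_C_mul_le c (a ^ i)
  refine (natDegree_mul_le_of_le (h3.trans h1) h2).trans ?_
  obtain ⟨j, rfl⟩ := Nat.exists_eq_add_of_le hi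
  rw [Nat.add_sub_cancel_left]
  apply le_of_eq
  ring

lemma natDegree_homogEval_le (ha : a.natDegree ≤ k + 1) (hb : b.natDegree ≤ k) :
    (homogEval a b n f).natDegree ≤ n * (k + 1) := by
  refine natDegree_sum_le_of_forall_le _ _ fun i hi ↦ ?_
  have hi' : i ≤ n := Nat.lt_succ_iff.1 (Finset.mem_range.1 hi)
  refine (natDegree_homogEval_term ha hb _ hi').trans ?_
  rw [mul_add, mul_one]
  omega

/-- The `i`-th term has degree at most `n * k + i`, so only `i = n` contributes. -/
lemma coeff_homogEval (ha : a.natDegree ≤ k + 1) (hb : b.natDegree ≤ k) :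
    (homogEval a b n f).coeff (n * (k + 1)) = f.coeff n * a.coeff (k + 1) ^ n := by
  rw [homogEval, finsetSum_coeff, Finset.sum_range_succ, Finset.sum_eq_zero, zero_add,
    Nat.sub_self, pow_zero, mul_one, coeff_C_mul, coeff_pow_of_natDegree_le ha]
  intro i hi
  have hi' := Finset.mem_range.1 hi
  refine coeff_eq_zero_of_natDegree_lt
    ((natDegree_homogEval_term ha hb _ hi'.le).trans_lt ?_)
  rw [mul_add, mul_one]
  omega

end HomogEval

/-! ### The damped Traub map as a quotient of polynomials -/

/-- The numerator of Newton's map over the denominator `p'`. -/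
def newtonNum (p : ℂ[X]) : ℂ[X] := X * derivative p - p

/-- The numerator of the damped Traub map over the denominator `p' ^ (deg p + 1)`. -/
def traubNum (p : ℂ[X]) (δ : ℂ) : ℂ[X] :=
  newtonNum p * derivative p ^ p.natDegree -
    C δ * homogEval (newtonNum p) (derivative p) p.natDegree p

/-- The polynomial `p' ^ deg p * bracket p δ`, whose zeros carry the critical points of the damped
Traub map. -/
def critPoly (p : ℂ[X]) (δ : ℂ) : ℂ[X] :=
  p * derivative p ^ p.natDegree -
    C δ * (p * homogEval (newtonNum p) (derivative p) (p.natDegree - 1) (derivative p)) +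
    C δ * homogEval (newtonNum p) (derivative p) p.natDegree p

variable {p : ℂ[X]} {δ : ℂ}

lemma derivative_newtonNum : derivative (newtonNum p) = X * derivative (derivative p) := by
  simp only [newtonNum, derivative_sub, derivative_mul, derivative_X]
  ring

/-- This is the product and chain rule for `p'^(n+1) f(N_p)` with `N_p' = p p'' / p'^2`, multiplied
by `p'` to clear the denominator. The check is term by term, so no bound on the degree of `f` is
needed. -/
lemma derivative_homogEval_newtonNum (n : ℕ) (f : ℂ[X]) :
    derivative (homogEval (newtonNum p) (derivative p) (n + 1) f) * derivative p =
      derivative (derivative p) *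
        (p * homogEval (newtonNum p) (derivative p) n (derivative f) +
          C (n + 1 : ℂ) * homogEval (newtonNum p) (derivative p) (n + 1) f) := by
  have hterm : ∀ i ∈ Finset.range (n + 1 + 1),
      derivative (C (f.coeff i) * newtonNum p ^ i * derivative p ^ (n + 1 - i)) * derivative p =
      derivative (derivative p) * (p * (C (f.coeff i * i) * newtonNum p ^ (i - 1) *
          derivative p ^ (n + 1 - i)) +
        C (n + 1 : ℂ) * (C (f.coeff i) * newtonNum p ^ i * derivative p ^ (n + 1 - i))) := by
    intro i hi
    -- Writing `n + 1 = i + j` removes the truncated subtraction. In `h1` and `h2` the factors `i`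
    -- and `j` absorb the exponents `i - 1` and `j - 1` at zero.
    obtain ⟨j, hj⟩ := Nat.exists_eq_add_of_le (Nat.lt_succ_iff.1 (Finset.mem_range.1 hi))
    rw [hj, Nat.add_sub_cancel_left, ← Nat.cast_succ, Nat.succ_eq_add_one, hj]
    simp only [derivative_mul, derivative_C, derivative_pow, derivative_newtonNum, C_mul,
      C_eq_natCast]
    have hL : X * derivative p = newtonNum p + p := by rw [newtonNum]; ring
    have h1 : (i : ℂ[X]) * newtonNum p ^ (i - 1) * newtonNum p = i * newtonNum p ^ i := by
      rcases i with _ | i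
      · simp
      · rw [Nat.add_sub_cancel, pow_succ]; ring
    have h2 : (j : ℂ[X]) * derivative p ^ (j - 1) * derivative p = j * derivative p ^ j := by
      rcases j with _ | j
      · simp
      · rw [Nat.add_sub_cancel, pow_succ]; ring
    push_cast
    linear_combination C (f.coeff i) * i * newtonNum p ^ (i - 1) * derivative (derivative p) *
      derivative p ^ j * hL + C (f.coeff i) * derivative (derivative p) * derivative p ^ j * h1 +
      C (f.coeff i) * newtonNum p ^ i * derivative (derivative p) * h2
  have hshift : ∑ i ∈ Finset.range (n + 1 + 1), C (f.coeff i * i) * newtonNum p ^ (i - 1) *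
      derivative p ^ (n + 1 - i) =
      homogEval (newtonNum p) (derivative p) n (derivative f) := by
    rw [Finset.sum_range_succ', homogEval]
    simp only [coeff_derivative, Nat.cast_zero, mul_zero, C_0, zero_mul, add_zero,
      Nat.add_sub_cancel, Nat.add_sub_add_right, Nat.cast_add, Nat.cast_one]
  rw [← hshift, homogEval, derivative_sum, Finset.sum_mul, Finset.mul_sum, Finset.mul_sum,
    ← Finset.sum_add_distrib, Finset.mul_sum]
  exact Finset.sum_congr rfl hterm

lemma natDegree_derivative_eq_sub_one (p : ℂ[X]) :
    (derivative p).natDegree = p.natDegree - 1 := by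
  exact natDegree_derivative p

lemma derivative_ne_zero (hd : 2 ≤ p.natDegree) : derivative p ≠ 0 := by
  intro h
  have := derivative_eq_zero.1 h
  omega

lemma derivative_derivative_ne_zero (hd : 2 ≤ p.natDegree) : derivative (derivative p) ≠ 0 := by
  intro h
  have h1 := derivative_eq_zero.1 h
  rw [natDegree_derivative_eq_sub_one] at h1
  omega

/-- Cleared of denominators, this is `T' = p'' B / p'^2`. -/
lemma wronskian_traubNum (hd : 2 ≤ p.natDegree) (δ : ℂ) :
    derivative (traubNum p δ) * derivative p ^ (p.natDegree + 1) -
      traubNum p δ * derivative (derivative p ^ (p.natDegree + 1)) =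
    derivative p ^ p.natDegree * derivative (derivative p) * critPoly p δ := by
  obtain ⟨n, hn⟩ : ∃ n, p.natDegree = n + 1 := ⟨p.natDegree - 1, by omega⟩
  have h := derivative_homogEval_newtonNum (p := p) n p
  simp only [traubNum, critPoly, hn, Nat.add_sub_cancel, derivative_sub, derivative_mul,
    derivative_C, derivative_pow, derivative_newtonNum, Nat.cast_add, Nat.cast_one]
  simp only [C_add, C_1, C_eq_natCast, newtonNum] at h ⊢
  linear_combination (-C δ) * derivative p ^ (n + 1) * h

lemma newton_eq_quot (hd : 2 ≤ p.natDegree) :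
    newton p = quot (newtonNum p) (derivative p) := by
  have h := RatFunc.algebraMap_ne_zero (derivative_ne_zero hd)
  rw [newton, quot, newtonNum, map_sub, map_mul, RatFunc.algebraMap_X, sub_div,
    mul_div_cancel_right₀ _ h]

lemma traub_eq_quot (hd : 2 ≤ p.natDegree) (δ : ℂ) :
    traub p δ = quot (traubNum p δ) (derivative p ^ (p.natDegree + 1)) := by
  have hq := derivative_ne_zero hd
  have h := RatFunc.algebraMap_ne_zero hq
  rw [traub, newton_eq_quot hd, quot, quot, traubNum, map_sub, map_mul, map_mul,
    algebraMap_homogEval hq le_rfl, map_pow, map_pow, RatFunc.algebraMap_C, quot]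
  field_simp
  ring

/-! ### Zeros of `p'` -/

lemma eval_newtonNum_of_derivative {z : ℂ} (hz : (derivative p).eval z = 0) :
    (newtonNum p).eval z = -p.eval z := by
  simp [newtonNum, hz]

lemma eval_ne_zero_of_derivative (hd : 2 ≤ p.natDegree)
    (hs : ∀ α : ℂ, p.eval α = 0 → p.rootMultiplicity α = 1) {z : ℂ}
    (hz : (derivative p).eval z = 0) : p.eval z ≠ 0 := by
  intro h
  have h0 : p ≠ 0 := by rintro rfl; simp at hd
  have h1 := rootMultiplicity_eq_derivative_add_one h0 h
  have h2 := rootMultiplicity_pos_of_eval_eq (derivative_ne_zero hd) hz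
  have := hs z h
  omega

/-- Only the top term of the homogenisation survives where `p' = 0`, leaving `-δ a (-p(z))^d` with
`a` the leading coefficient. -/
lemma traubNum_eval_ne_zero (hd : 2 ≤ p.natDegree)
    (hs : ∀ α : ℂ, p.eval α = 0 → p.rootMultiplicity α = 1) (hδ : δ ≠ 0) {z : ℂ}
    (hz : (derivative p).eval z = 0) : (traubNum p δ).eval z ≠ 0 := by
  have hp := eval_ne_zero_of_derivative hd hs hz
  have h0 : p ≠ 0 := by rintro rfl; simp at hd
  have hd0 : p.natDegree ≠ 0 := by omega
  have hl := leadingCoeff_ne_zero.2 h0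
  rw [leadingCoeff] at hl
  simp only [traubNum, eval_sub, eval_mul, eval_pow, hz, eval_C, eval_homogEval_of_eq_zero hz,
    eval_newtonNum_of_derivative hz, zero_pow hd0, mul_zero, zero_sub, neg_ne_zero]
  exact mul_ne_zero hδ (mul_ne_zero hl (pow_ne_zero _ (neg_ne_zero.2 hp)))

lemma critPoly_eval_ne_zero (hd : 2 ≤ p.natDegree)
    (hs : ∀ α : ℂ, p.eval α = 0 → p.rootMultiplicity α = 1) (hδ : δ ≠ 0) {z : ℂ}
    (hz : (derivative p).eval z = 0) : (critPoly p δ).eval z ≠ 0 := by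
  have hp := eval_ne_zero_of_derivative hd hs hz
  have h0 : p ≠ 0 := by rintro rfl; simp at hd
  obtain ⟨n, hn⟩ : ∃ n, p.natDegree = n + 1 := ⟨p.natDegree - 1, by omega⟩
  have hl := leadingCoeff_ne_zero.2 h0
  rw [leadingCoeff, hn] at hl
  have hn2 : (n : ℂ) + 1 + 1 ≠ 0 := by norm_cast
  -- The surviving top terms of the two homogenisations contribute `d` and `1`, hence the factor `d
  -- + 1`.
  have key : (critPoly p δ).eval z =
      δ * (p.coeff (n + 1) * ((-p.eval z) ^ (n + 1) * ((n : ℂ) + 1 + 1))) := by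
    simp only [critPoly, eval_sub, eval_add, eval_mul, eval_pow, hz, eval_C,
      eval_homogEval_of_eq_zero hz, eval_newtonNum_of_derivative hz, hn, Nat.add_sub_cancel,
      coeff_derivative]
    ring
  rw [key]
  exact mul_ne_zero hδ (mul_ne_zero hl (mul_ne_zero (pow_ne_zero _ (neg_ne_zero.2 hp)) hn2))

lemma isCoprime_traubNum (hd : 2 ≤ p.natDegree)
    (hs : ∀ α : ℂ, p.eval α = 0 → p.rootMultiplicity α = 1) (hδ : δ ≠ 0) :
    IsCoprime (traubNum p δ) (derivative p ^ (p.natDegree + 1)) := by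
  refine IsCoprime.pow_right ?_
  rw [isCoprime_iff_aeval_ne_zero_of_isAlgClosed ℂ ℂ]
  intro z
  simp only [coe_aeval_eq_eval]
  by_cases h : (derivative p).eval z = 0
  · exact Or.inl (traubNum_eval_ne_zero hd hs hδ h)
  · exact Or.inr h

lemma exists_root_derivative (hd : 2 ≤ p.natDegree) : ∃ z : ℂ, (derivative p).eval z = 0 := by
  refine IsAlgClosed.exists_root _ (ne_of_gt ?_)
  rw [← natDegree_pos_iff_degree_pos, natDegree_derivative_eq_sub_one]
  omega

lemma traubNum_ne_zero (hd : 2 ≤ p.natDegree)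
    (hs : ∀ α : ℂ, p.eval α = 0 → p.rootMultiplicity α = 1) (hδ : δ ≠ 0) : traubNum p δ ≠ 0 := by
  obtain ⟨z, hz⟩ := exists_root_derivative hd
  intro h
  simpa [h] using traubNum_eval_ne_zero hd hs hδ hz

lemma critPoly_ne_zero (hd : 2 ≤ p.natDegree)
    (hs : ∀ α : ℂ, p.eval α = 0 → p.rootMultiplicity α = 1) (hδ : δ ≠ 0) : critPoly p δ ≠ 0 := by
  obtain ⟨z, hz⟩ := exists_root_derivative hd
  intro h
  simpa [h] using critPoly_eval_ne_zero hd hs hδ hz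

/-! ### The critical multiplicity at a finite point -/

lemma rootMultiplicity_pow' {f : ℂ[X]} (hf : f ≠ 0) (n : ℕ) (z : ℂ) :
    (f ^ n).rootMultiplicity z = n * f.rootMultiplicity z := by
  induction n with
  | zero => simp [rootMultiplicity_eq_zero]
  | succ n ih => rw [pow_succ, rootMultiplicity_mul (mul_ne_zero (pow_ne_zero _ hf) hf), ih]; ring

/-- Off the poles this is the order of the Wronskian plus one. At a pole the local degree is `(d+1)
ord p'`, and `ord p' = ord p'' + 1` brings it to the same form. -/
lemma localDegree_traub (hd : 2 ≤ p.natDegree)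
    (hs : ∀ α : ℂ, p.eval α = 0 → p.rootMultiplicity α = 1) (hδ : δ ≠ 0) (z : ℂ) :
    localDegree (traub p δ) (z : OnePoint ℂ) =
      p.natDegree * (derivative p).rootMultiplicity z +
        (derivative (derivative p)).rootMultiplicity z +
        (critPoly p δ).rootMultiplicity z + 1 := by
  have hq := derivative_ne_zero hd
  have hB := critPoly_ne_zero hd hs hδ
  have hco := isCoprime_traubNum hd hs hδ
  rw [traub_eq_quot hd]
  by_cases hz : (derivative p).eval z = 0
  · have h1 := rootMultiplicity_eq_derivative_add_one hq hz
    rw [localDegree_quot_pole hco (traubNum_ne_zero hd hs hδ) (pow_ne_zero _ hq) (by simp [hz]),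
      rootMultiplicity_pow' hq,
      rootMultiplicity_eq_zero_of_eval_ne (critPoly_eval_ne_zero hd hs hδ hz), add_mul, one_mul]
    omega
  · have h2 : derivative p ^ p.natDegree * derivative (derivative p) ≠ 0 :=
      mul_ne_zero (pow_ne_zero _ hq) (derivative_derivative_ne_zero hd)
    rw [localDegree_quot_eq_wronskian hco, wronskian_traubNum hd,
      rootMultiplicity_mul (mul_ne_zero h2 hB), rootMultiplicity_mul h2, rootMultiplicity_pow' hq]
    · rw [wronskian_traubNum hd]
      exact mul_ne_zero h2 hB
    · simpa using hz

lemma critMult_traub (hd : 2 ≤ p.natDegree)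
    (hs : ∀ α : ℂ, p.eval α = 0 → p.rootMultiplicity α = 1) (hδ : δ ≠ 0) (z : ℂ) :
    critMult (traub p δ) (z : OnePoint ℂ) =
      p.natDegree * (derivative p).rootMultiplicity z +
        (derivative (derivative p)).rootMultiplicity z +
        (critPoly p δ).rootMultiplicity z := by
  rw [critMult, localDegree_traub hd hs hδ, Nat.add_sub_cancel]

lemma value_traub_of_derivative (hd : 2 ≤ p.natDegree)
    (hs : ∀ α : ℂ, p.eval α = 0 → p.rootMultiplicity α = 1) (hδ : δ ≠ 0) {z : ℂ}
    (hz : (derivative p).eval z = 0) :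
    value (traub p δ) (z : OnePoint ℂ) = OnePoint.infty := by
  rw [traub_eq_quot hd]
  exact value_quot_of_eval_eq_zero (isCoprime_traubNum hd hs hδ)
    (pow_ne_zero _ (derivative_ne_zero hd)) (by simp [hz])

lemma eval_critPoly (hd : 2 ≤ p.natDegree) (δ : ℂ) {z : ℂ} (hz : (derivative p).eval z ≠ 0) :
    (critPoly p δ).eval z = (derivative p).eval z ^ p.natDegree * bracket p δ z := by
  obtain ⟨n, hn⟩ : ∃ n, p.natDegree = n + 1 := ⟨p.natDegree - 1, by omega⟩
  have hN : (newtonNum p).eval z / (derivative p).eval z = z - p.eval z / (derivative p).eval z := by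
    simp only [newtonNum, eval_sub, eval_mul, eval_X]
    field_simp
  simp only [critPoly, bracket, eval_sub, eval_add, eval_mul, eval_pow, eval_C]
  rw [eval_homogEval_of_ne_zero hz (natDegree_derivative_eq_sub_one p).le,
    eval_homogEval_of_ne_zero hz le_rfl, hN, hn, Nat.add_sub_cancel, pow_succ]
  field_simp

/-! ### Zeros of `p` -/

/-- The numerator of `T - α` factors as `E * F`, where `E = p' (N_p - α)` has order `m + 2` and `F`
takes the value `(1 - δ) p'(α)^d` at `α`. The order of `E * F` is the local degree, and
`localDegree_traub` is then solved for the order of `critPoly`. -/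
lemma rootMultiplicity_critPoly_of_root (hd : 2 ≤ p.natDegree)
    (hs : ∀ α : ℂ, p.eval α = 0 → p.rootMultiplicity α = 1) (hδ : δ ≠ 0) {α : ℂ}
    (hα : p.eval α = 0) :
    (δ ≠ 1 → (critPoly p δ).rootMultiplicity α = 1) ∧
    (δ = 1 → (critPoly p δ).rootMultiplicity α =
      (derivative (derivative p)).rootMultiplicity α + 2) := by
  have hq := derivative_ne_zero hd
  have hqq := derivative_derivative_ne_zero hd
  have hqα : (derivative p).eval α ≠ 0 := fun h ↦ eval_ne_zero_of_derivative hd hs h hα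
  obtain ⟨n, hn⟩ : ∃ n, p.natDegree = n + 2 := ⟨p.natDegree - 2, by omega⟩
  set m := (derivative (derivative p)).rootMultiplicity α with hm
  set q := derivative p with hqdef
  set c := q.eval α with hc
  obtain ⟨r, hr⟩ := dvd_iff_isRoot.2 hα
  have hrα : r.eval α = c := by
    rw [hc, hqdef, hr]; simp
  have hr0 : r ≠ 0 := by rintro rfl; simp at hrα; exact hqα hrα.symm
  have hrdeg : r.natDegree = n + 1 := by
    have h := congrArg natDegree hr
    rw [natDegree_mul (X_sub_C_ne_zero α) hr0, natDegree_X_sub_C] at h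
    omega
  obtain ⟨s, hs'⟩ : (X - C α) ∣ r - C c := by
    apply dvd_iff_isRoot.2
    simp [hrα]
  have hr1 : r = C c + (X - C α) * s := by rw [← hs']; ring
  have hsdeg : s.natDegree ≤ n := by
    by_cases h0 : s = 0
    · simp [h0]
    have h := congrArg natDegree hs'
    rw [natDegree_mul (X_sub_C_ne_zero α) h0, natDegree_X_sub_C, natDegree_sub_C] at h
    omega
  set L := newtonNum p with hL
  set E := L - C α * q with hE
  have hY : homogEval L q (n + 2) p = E * homogEval L q (n + 1) r := by
    nth_rw 1 [hr]
    rw [homogEval_mul_linear hq hrdeg.le]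
  have hR : homogEval L q (n + 1) r = C c * q ^ (n + 1) + E * homogEval L q n s := by
    nth_rw 1 [hr1]
    rw [homogEval_add, homogEval_C, homogEval_mul_linear hq hsdeg]
  have hLα : L.eval α = α * c := by simp [hL, newtonNum, hα, hc, hqdef]
  have hEα : E.eval α = 0 := by simp [hE, hLα, hc]
  -- The derivative of `E` is explicit, so its order `m + 1` gives the order of `E`.
  have hE' : derivative E = (X - C α) * derivative q := by
    rw [hE, derivative_sub, hL, derivative_newtonNum, derivative_C_mul]
    ring
  have hE'0 : derivative E ≠ 0 := hE' ▸ mul_ne_zero (X_sub_C_ne_zero α) hqq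
  have hE0 : E ≠ 0 := by intro h; simp [h] at hE'0
  have hEm : E.rootMultiplicity α = m + 2 := by
    rw [rootMultiplicity_eq_derivative_add_one hE0 hEα, hE',
      rootMultiplicity_mul (mul_ne_zero (X_sub_C_ne_zero α) hqq), rootMultiplicity_X_sub_C_self]
    omega
  set F := q ^ (n + 2) - C δ * homogEval L q (n + 1) r with hF
  have hA : traubNum p δ - C α * q ^ (n + 2 + 1) = E * F := by
    rw [traubNum, hn, hY, hF, ← hqdef, ← hL, hE]
    ring
  have hFα : F.eval α = (1 - δ) * c ^ (n + 2) := by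
    rw [hF, hR]
    simp only [eval_sub, eval_mul, eval_add, eval_pow, eval_C, hEα, ← hc]
    ring
  have hval : (traubNum p δ).eval α / (q ^ (n + 2 + 1)).eval α = α := by
    have h := congrArg (eval α) hA
    simp only [eval_sub, eval_mul, eval_C, hEα, zero_mul] at h
    rw [sub_eq_zero.1 h, mul_div_cancel_right₀]
    simpa using hqα
  have hQα : (q ^ (n + 2 + 1)).eval α ≠ 0 := by simpa using hqα
  have hloc : ∀ k, F ≠ 0 → F.rootMultiplicity α = k →
      (critPoly p δ).rootMultiplicity α = k + 1 := by
    intro k hF0 hk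
    have hco := isCoprime_traubNum hd hs hδ
    rw [hn] at hco
    have h1 := localDegree_traub hd hs hδ α
    rw [traub_eq_quot hd, hn, localDegree_quot_of_eval_ne_zero hco hQα, ← hqdef, hval, hA,
      rootMultiplicity_mul (mul_ne_zero hE0 hF0), hEm, hk,
      rootMultiplicity_eq_zero_of_eval_ne hqα] at h1
    · omega
    · rw [← hqdef, hval, hA]; exact mul_ne_zero hE0 hF0
  constructor
  · intro h1
    have hFα' : F.eval α ≠ 0 := by
      rw [hFα]; exact mul_ne_zero (sub_ne_zero.2 (Ne.symm h1)) (pow_ne_zero _ hqα)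
    exact hloc 0 (by rintro h; simp [h] at hFα') (rootMultiplicity_eq_zero_of_eval_ne hFα')
  · intro h1
    have hqc' : derivative (q - C c) = derivative q := by simp
    have hqc0 : q - C c ≠ 0 := by
      intro h; rw [h, derivative_zero] at hqc'; exact hqq hqc'.symm
    have hqcm : (q - C c).rootMultiplicity α = m + 1 := by
      rw [rootMultiplicity_eq_derivative_add_one hqc0 (by simp [hc]), hqc']
    have hprod : q ^ (n + 1) * (q - C c) ≠ 0 := mul_ne_zero (pow_ne_zero _ hq) hqc0
    have hprodm : (q ^ (n + 1) * (q - C c)).rootMultiplicity α = m + 1 := by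
      rw [rootMultiplicity_mul hprod, rootMultiplicity_pow' hq,
        rootMultiplicity_eq_zero_of_eval_ne hqα, hqcm]
      omega
    -- For `δ = 1` the constant part `c` of `r` combines with `q`; the product with `q - c` has
    -- order `m + 1`, and the other term is divisible by `E`, of order `m + 2`.
    have hF' : F = q ^ (n + 1) * (q - C c) + -(E * homogEval L q n s) := by
      rw [hF, hR, h1, C_1]; ring
    have hFm : F.rootMultiplicity α = m + 1 := by
      rw [hF', rootMultiplicity_add_eq_left hprod, hprodm]
      rw [hprodm, ← hEm]
      exact ((pow_rootMultiplicity_dvd E α).mul_right _).neg_right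
    have hF0 : F ≠ 0 := by intro h; simp [h] at hFm
    exact hloc (m + 1) hF0 hFm

/-! ### Degrees and the point at infinity -/

lemma natDegree_newtonNum_le {k : ℕ} (hk : p.natDegree = k + 1) :
    (newtonNum p).natDegree ≤ k + 1 := by
  refine (natDegree_sub_le _ _).trans (max_le ?_ hk.le)
  refine natDegree_mul_le.trans ?_
  rw [natDegree_X, natDegree_derivative_eq_sub_one]
  omega

lemma coeff_newtonNum {k : ℕ} (hk : p.natDegree = k + 1) :
    (newtonNum p).coeff (k + 1) = k * p.leadingCoeff := by
  rw [newtonNum, coeff_sub, coeff_X_mul, coeff_derivative, leadingCoeff, hk]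
  ring

lemma natDegree_derivative_le_of_eq {k : ℕ} (hk : p.natDegree = k + 1) :
    (derivative p).natDegree ≤ k := by
  rw [natDegree_derivative_eq_sub_one, hk, Nat.add_sub_cancel]

lemma coeff_derivative_pow {k : ℕ} (hk : p.natDegree = k + 1) (n : ℕ) :
    (derivative p ^ n).coeff (n * k) = ((k + 1) * p.leadingCoeff) ^ n := by
  rw [coeff_pow_of_natDegree_le (natDegree_derivative_le_of_eq hk), coeff_derivative, leadingCoeff,
    hk, mul_comm]

/-- The number `d ^ d - δ (d - 1) ^ (d - 1)` with `d = k + 1`, which vanishes exactly at the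
degeneracy parameter. -/
def degeneracy (k : ℕ) (δ : ℂ) : ℂ := ((k : ℂ) + 1) ^ (k + 1) - δ * (k : ℂ) ^ k

lemma degeneracy_eq_zero_iff {k : ℕ} (hk : 1 ≤ k) :
    degeneracy k δ = 0 ↔ δ = degenerateParam (k + 1) := by
  have h : (k : ℂ) ^ k ≠ 0 := pow_ne_zero _ (by norm_cast; omega)
  rw [degeneracy, degenerateParam, Nat.add_sub_cancel, Nat.cast_add, Nat.cast_one,
    add_sub_cancel_right, eq_div_iff h, sub_eq_zero, eq_comm]

/-- Indeed `d^d > (d-1)^(d-1)`. This keeps the cases `δ = 1` and `δ = δ_*` apart. -/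
lemma degenerateParam_ne_one {d : ℕ} (hd : 2 ≤ d) : degenerateParam d ≠ 1 := by
  obtain ⟨k, rfl⟩ : ∃ k, d = k + 1 := ⟨d - 1, by omega⟩
  intro h
  have h1 := (degeneracy_eq_zero_iff (by omega)).2 h.symm
  rw [degeneracy, one_mul, sub_eq_zero] at h1
  norm_cast at h1
  have h2 : k ^ k ≤ (k + 1) ^ k := Nat.pow_le_pow_left (by omega) k
  have h3 : (k + 1) ^ k < (k + 1) ^ (k + 1) := Nat.pow_lt_pow_right (by omega) (by omega)
  omega

lemma natDegree_traubNum_le {k : ℕ} (hk : p.natDegree = k + 1) :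
    (traubNum p δ).natDegree ≤ (k + 1) * (k + 1) := by
  have hL := natDegree_newtonNum_le hk
  have hq := natDegree_derivative_le_of_eq hk
  rw [traubNum, hk]
  refine (natDegree_sub_le _ _).trans (max_le ?_ ?_)
  · refine (natDegree_mul_le_of_le hL (natDegree_pow_le_of_le _ hq)).trans (le_of_eq (by ring))
  · exact (natDegree_C_mul_le _ _).trans (natDegree_homogEval_le hL hq)

lemma coeff_traubNum {k : ℕ} (hk : p.natDegree = k + 1) :
    (traubNum p δ).coeff ((k + 1) * (k + 1)) =
      p.leadingCoeff ^ (k + 2) * (k * degeneracy k δ) := by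
  have hL := natDegree_newtonNum_le hk
  have hq := natDegree_derivative_le_of_eq hk
  have hl : p.coeff (k + 1) = p.leadingCoeff := by rw [leadingCoeff, hk]
  rw [traubNum, hk, coeff_sub, coeff_C_mul, coeff_homogEval hL hq,
    show (k + 1) * (k + 1) = (k + 1) + (k + 1) * k by ring,
    coeff_mul_add_eq_of_natDegree_le hL (natDegree_pow_le_of_le _ hq), coeff_derivative_pow hk,
    coeff_newtonNum hk, hl, degeneracy]
  simp only [mul_pow]
  ring

lemma natDegree_critPoly_le {k : ℕ} (hk : p.natDegree = k + 1) :
    (critPoly p δ).natDegree ≤ (k + 1) * (k + 1) := by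
  have hL := natDegree_newtonNum_le hk
  have hq := natDegree_derivative_le_of_eq hk
  rw [critPoly, hk, Nat.add_sub_cancel]
  refine (natDegree_add_le _ _).trans (max_le ((natDegree_sub_le _ _).trans (max_le ?_ ?_)) ?_)
  · refine (natDegree_mul_le_of_le hk.le (natDegree_pow_le_of_le _ hq)).trans (le_of_eq (by ring))
  · refine (natDegree_C_mul_le _ _).trans
      ((natDegree_mul_le_of_le hk.le (natDegree_homogEval_le hL hq)).trans (le_of_eq (by ring)))
  · exact (natDegree_C_mul_le _ _).trans (natDegree_homogEval_le hL hq)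

/-- The three terms contribute `(k+1)^(k+1) - δ (k+1) k^k + δ k^(k+1)`, and the last two combine to
`-δ k^k`. -/
lemma coeff_critPoly {k : ℕ} (hk : p.natDegree = k + 1) :
    (critPoly p δ).coeff ((k + 1) * (k + 1)) = p.leadingCoeff ^ (k + 2) * degeneracy k δ := by
  have hL := natDegree_newtonNum_le hk
  have hq := natDegree_derivative_le_of_eq hk
  have hl : p.coeff (k + 1) = p.leadingCoeff := by rw [leadingCoeff, hk]
  have h1 : (p * derivative p ^ (k + 1)).coeff ((k + 1) * (k + 1)) =
      p.leadingCoeff * ((k + 1) * p.leadingCoeff) ^ (k + 1) := by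
    rw [show (k + 1) * (k + 1) = (k + 1) + (k + 1) * k by ring,
      coeff_mul_add_eq_of_natDegree_le hk.le (natDegree_pow_le_of_le _ hq),
      coeff_derivative_pow hk, hl]
  have h2 : (p * homogEval (newtonNum p) (derivative p) k (derivative p)).coeff
      ((k + 1) * (k + 1)) =
      p.leadingCoeff * ((p.leadingCoeff * (k + 1)) * (k * p.leadingCoeff) ^ k) := by
    rw [show (k + 1) * (k + 1) = (k + 1) + k * (k + 1) by ring,
      coeff_mul_add_eq_of_natDegree_le hk.le (natDegree_homogEval_le hL hq),
      coeff_homogEval hL hq, coeff_derivative, coeff_newtonNum hk, hl]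
  rw [critPoly, hk, Nat.add_sub_cancel, coeff_add, coeff_sub, coeff_C_mul, coeff_C_mul, h1, h2,
    coeff_homogEval hL hq, coeff_newtonNum hk, hl, degeneracy]
  simp only [mul_pow]
  ring

lemma natDegree_derivative_pow {k : ℕ} (hk : p.natDegree = k + 1) (n : ℕ) :
    (derivative p ^ n).natDegree = n * k := by
  rw [natDegree_pow, natDegree_derivative_eq_sub_one, hk, Nat.add_sub_cancel]

lemma natDegree_traubNum_of_ne {k : ℕ} (hk : p.natDegree = k + 1) (hk1 : 1 ≤ k)
    (h : degeneracy k δ ≠ 0) : (traubNum p δ).natDegree = (k + 1) * (k + 1) := by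
  have h0 : p ≠ 0 := by rintro rfl; simp at hk
  refine natDegree_eq_of_le_of_coeff_ne_zero (natDegree_traubNum_le hk) ?_
  rw [coeff_traubNum hk]
  exact mul_ne_zero (pow_ne_zero _ (leadingCoeff_ne_zero.2 h0))
    (mul_ne_zero (by norm_cast; omega) h)

lemma natDegree_traubNum_lt {k : ℕ} (hk : p.natDegree = k + 1)
    (h : degeneracy k δ = 0) : (traubNum p δ).natDegree < (k + 1) * (k + 1) := by
  refine lt_of_le_of_ne (natDegree_traubNum_le hk) fun he ↦ ?_
  have h1 := coeff_traubNum (δ := δ) hk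
  rw [h, mul_zero, mul_zero, ← he, coeff_natDegree, leadingCoeff_eq_zero] at h1
  rw [h1, natDegree_zero] at he
  exact absurd he (by positivity)

lemma natDegree_critPoly_of_ne {k : ℕ} (hk : p.natDegree = k + 1)
    (h : degeneracy k δ ≠ 0) : (critPoly p δ).natDegree = (k + 1) * (k + 1) := by
  have h0 : p ≠ 0 := by rintro rfl; simp at hk
  refine natDegree_eq_of_le_of_coeff_ne_zero (natDegree_critPoly_le hk) ?_
  rw [coeff_critPoly hk]
  exact mul_ne_zero (pow_ne_zero _ (leadingCoeff_ne_zero.2 h0)) h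

lemma degree_traub {k : ℕ} (hk : p.natDegree = k + 1) (hk1 : 1 ≤ k)
    (hs : ∀ α : ℂ, p.eval α = 0 → p.rootMultiplicity α = 1) (hδ : δ ≠ 0) :
    degree (traub p δ) = if δ = degenerateParam (k + 1) then (k + 1) ^ 2 - 1 else (k + 1) ^ 2 := by
  have hd : 2 ≤ p.natDegree := by omega
  have h2 : (k + 1) ^ 2 = (k + 1 + 1) * k + 1 := by ring
  have h3 : (k + 1) * (k + 1) = (k + 1 + 1) * k + 1 := by ring
  rw [traub_eq_quot hd, degree_quot (isCoprime_traubNum hd hs hδ)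
    (pow_ne_zero _ (derivative_ne_zero hd)), natDegree_derivative_pow hk, hk]
  split_ifs with h
  · have := natDegree_traubNum_lt hk ((degeneracy_eq_zero_iff hk1).2 h)
    omega
  · have := natDegree_traubNum_of_ne hk hk1 (fun h' ↦ h ((degeneracy_eq_zero_iff hk1).1 h'))
    omega

/-- The numerator has degree `d^2` and the denominator `(d+1)(d-1) = d^2 - 1`, so infinity is a
simple pole. -/
lemma critMult_traub_infty_of_ne {k : ℕ} (hk : p.natDegree = k + 1) (hk1 : 1 ≤ k)
    (hs : ∀ α : ℂ, p.eval α = 0 → p.rootMultiplicity α = 1) (hδ : δ ≠ 0)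
    (h : degeneracy k δ ≠ 0) : critMult (traub p δ) OnePoint.infty = 0 := by
  have hd : 2 ≤ p.natDegree := by omega
  have h1 := natDegree_traubNum_of_ne hk hk1 h
  have h2 := natDegree_derivative_pow hk (p.natDegree + 1)
  have h3 : (k + 1) * (k + 1) = (k + 1 + 1) * k + 1 := by ring
  rw [hk] at h2
  rw [critMult, traub_eq_quot hd, localDegree_quot_infty_of_lt (isCoprime_traubNum hd hs hδ)
    (traubNum_ne_zero hd hs hδ) (pow_ne_zero _ (derivative_ne_zero hd))] <;> rw [hk] <;> omega

/-- Here `T` is finite at infinity. Neither summand need be known: the degree of the Wronskian fixes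
their sum, which is all the count uses. -/
lemma critMult_traub_infty_of_eq {k : ℕ} (hk : p.natDegree = k + 1) (hk1 : 1 ≤ k)
    (hs : ∀ α : ℂ, p.eval α = 0 → p.rootMultiplicity α = 1) (hδ : δ ≠ 0)
    (h : degeneracy k δ = 0) :
    critMult (traub p δ) OnePoint.infty + (critPoly p δ).natDegree + 2 = (k + 1) * (k + 1) := by
  have hd : 2 ≤ p.natDegree := by omega
  have h1 := natDegree_traubNum_lt hk h
  have h2 := natDegree_derivative_pow hk (p.natDegree + 1)
  have h3 : (k + 1) * (k + 1) = (k + 1 + 1) * k + 1 := by ring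
  have h4 : (k + 1 + 1) * k = (k + 1) * k + k := by ring
  have hq := derivative_ne_zero hd
  have hB := critPoly_ne_zero hd hs hδ
  have h5 : derivative p ^ p.natDegree * derivative (derivative p) ≠ 0 :=
    mul_ne_zero (pow_ne_zero _ hq) (derivative_derivative_ne_zero hd)
  have h6 := localDegree_quot_infty_add (isCoprime_traubNum hd hs hδ)
    (by rw [h2, hk]; omega) (by rw [h2, hk]; positivity)
    (by rw [wronskian_traubNum hd]; exact mul_ne_zero h5 hB)
  rw [← traub_eq_quot hd, wronskian_traubNum hd, natDegree_mul h5 hB,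
    natDegree_mul (pow_ne_zero _ hq) (derivative_derivative_ne_zero hd), h2,
    natDegree_derivative_pow hk, natDegree_derivative_eq_sub_one,
    natDegree_derivative_eq_sub_one, hk] at h6
  rw [critMult]
  omega

/-! ### The remaining critical points -/

lemma derivative_rootMultiplicity_of_root_eq_zero (hd : 2 ≤ p.natDegree)
    (hs : ∀ α : ℂ, p.eval α = 0 → p.rootMultiplicity α = 1) {α : ℂ} (hα : p.eval α = 0) :
    (derivative p).rootMultiplicity α = 0 :=
  rootMultiplicity_eq_zero_of_eval_ne fun h ↦ eval_ne_zero_of_derivative hd hs h hα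

lemma rootMultiplicity_critPoly_ge (hd : 2 ≤ p.natDegree)
    (hs : ∀ α : ℂ, p.eval α = 0 → p.rootMultiplicity α = 1) (hδ : δ ≠ 0) (z : ℂ) :
    (if δ = 1 then 2 else 1) * p.rootMultiplicity z ≤ (critPoly p δ).rootMultiplicity z := by
  by_cases hz : p.eval z = 0
  · obtain ⟨h1, h2⟩ := rootMultiplicity_critPoly_of_root hd hs hδ hz
    rw [hs z hz]
    split_ifs with h
    · rw [h2 h]; omega
    · rw [h1 h]
  · rw [rootMultiplicity_eq_zero_of_eval_ne hz, mul_zero]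
    exact Nat.zero_le _

lemma accountedMult_coe (z : ℂ) : accountedMult p δ (z : OnePoint ℂ) =
    (if δ = 1 then 2 else 1) * p.rootMultiplicity z
        + p.natDegree * (derivative p).rootMultiplicity z
        + (derivative (derivative p)).rootMultiplicity z := rfl

lemma accountedMult_le_critMult (hd : 2 ≤ p.natDegree)
    (hs : ∀ α : ℂ, p.eval α = 0 → p.rootMultiplicity α = 1) (hδ : δ ≠ 0) (x : OnePoint ℂ) :
    accountedMult p δ x ≤ critMult (traub p δ) x := by
  induction x using OnePoint.rec with
  | infty => exact Nat.zero_le _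
  | coe z =>
    rw [accountedMult_coe, critMult_traub hd hs hδ]
    have := rootMultiplicity_critPoly_ge hd hs hδ z
    omega

lemma critMult_sub_accountedMult_coe (hd : 2 ≤ p.natDegree)
    (hs : ∀ α : ℂ, p.eval α = 0 → p.rootMultiplicity α = 1) (hδ : δ ≠ 0) (z : ℂ) :
    critMult (traub p δ) z - accountedMult p δ z =
      (critPoly p δ).rootMultiplicity z - (if δ = 1 then 2 else 1) * p.rootMultiplicity z := by
  rw [accountedMult_coe, critMult_traub hd hs hδ]
  omega

open scoped Classical in
lemma sum_rootMultiplicity_of_subset {f : ℂ[X]} {S : Finset ℂ} (hS : f.roots.toFinset ⊆ S) :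
    ∑ z ∈ S, f.rootMultiplicity z = f.natDegree := by
  rw [← splits_iff_card_roots.1 (IsAlgClosed.splits f)]
  simp only [← count_roots]
  exact Multiset.sum_count_eq_card fun a ha ↦ hS (Multiset.mem_toFinset.2 ha)

open scoped Classical in
/-- A finite set of points of the sphere that contains all critical points. -/
def supportSet (p : ℂ[X]) (δ : ℂ) : Finset (OnePoint ℂ) :=
  insert OnePoint.infty
    (((critPoly p δ).roots.toFinset ∪ p.roots.toFinset ∪ (derivative p).roots.toFinset ∪
      (derivative (derivative p)).roots.toFinset).image fun z : ℂ ↦ (z : OnePoint ℂ))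

open scoped Classical in
lemma mem_supportSet_of_critMult_ne_zero (hd : 2 ≤ p.natDegree)
    (hs : ∀ α : ℂ, p.eval α = 0 → p.rootMultiplicity α = 1) (hδ : δ ≠ 0) {x : OnePoint ℂ}
    (hx : critMult (traub p δ) x ≠ 0) : x ∈ supportSet p δ := by
  induction x using OnePoint.rec with
  | infty => simp [supportSet]
  | coe z =>
    have hq := derivative_ne_zero hd
    have hqq := derivative_derivative_ne_zero hd
    have hB := critPoly_ne_zero hd hs hδ
    rw [critMult_traub hd hs hδ] at hx
    have h : z ∈ (critPoly p δ).roots ∨ z ∈ (derivative p).roots ∨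
        z ∈ (derivative (derivative p)).roots := by
      by_contra! h
      simp only [mem_roots hq, mem_roots hqq, mem_roots hB, IsRoot.def] at h
      rw [rootMultiplicity_eq_zero_of_eval_ne h.1, rootMultiplicity_eq_zero_of_eval_ne h.2.1,
        rootMultiplicity_eq_zero_of_eval_ne h.2.2] at hx
      exact hx rfl
    rw [supportSet, Finset.mem_insert, Finset.mem_image]
    refine Or.inr ⟨z, ?_, rfl⟩
    simp only [Finset.mem_union, Multiset.mem_toFinset]
    tauto

lemma remainingCount_eq_sum (hd : 2 ≤ p.natDegree)
    (hs : ∀ α : ℂ, p.eval α = 0 → p.rootMultiplicity α = 1) (hδ : δ ≠ 0) :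
    remainingCount p δ =
      ∑ x ∈ supportSet p δ, (critMult (traub p δ) x - accountedMult p δ x) := by
  refine finsum_eq_sum_of_support_subset _ fun x hx ↦ ?_
  refine mem_supportSet_of_critMult_ne_zero hd hs hδ fun h ↦ hx ?_
  simp only [h, Nat.zero_sub]

open scoped Classical in
-- At finite points the `p'` and `p''` terms cancel, leaving `ord critPoly - ε ord p`, a genuine
-- difference by `rootMultiplicity_critPoly_ge`. Over `ℂ` the orders sum to the degrees.
lemma remainingCount_add (hd : 2 ≤ p.natDegree)
    (hs : ∀ α : ℂ, p.eval α = 0 → p.rootMultiplicity α = 1) (hδ : δ ≠ 0) :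
    remainingCount p δ + (if δ = 1 then 2 else 1) * p.natDegree =
      critMult (traub p δ) OnePoint.infty + (critPoly p δ).natDegree := by
  rw [remainingCount_eq_sum hd hs hδ, supportSet, Finset.sum_insert (by simp),
    Finset.sum_image (fun a _ b _ h ↦ OnePoint.coe_injective h)]
  simp only [critMult_sub_accountedMult_coe hd hs hδ]
  set S := (critPoly p δ).roots.toFinset ∪ p.roots.toFinset ∪ (derivative p).roots.toFinset ∪
      (derivative (derivative p)).roots.toFinset with hS
  have h1 : ∑ z ∈ S, (critPoly p δ).rootMultiplicity z = (critPoly p δ).natDegree :=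
    sum_rootMultiplicity_of_subset (by intro z hz; simp only [hS, Finset.mem_union]; tauto)
  have h2 : ∑ z ∈ S, p.rootMultiplicity z = p.natDegree :=
    sum_rootMultiplicity_of_subset (by intro z hz; simp only [hS, Finset.mem_union]; tauto)
  have h3 : accountedMult p δ OnePoint.infty = 0 := rfl
  rw [h3, Nat.sub_zero, add_assoc, ← h1, ← h2, Finset.mul_sum, ← Finset.sum_add_distrib]
  congr 1
  exact Finset.sum_congr rfl fun z _ ↦ Nat.sub_add_cancel (rootMultiplicity_critPoly_ge hd hs hδ z)

lemma accountedMult_of_mem_otherPoints {x : OnePoint ℂ} (hx : x ∈ otherPoints p) :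
    accountedMult p δ x = 0 := by
  induction x using OnePoint.rec with
  | infty => rfl
  | coe z =>
    obtain ⟨h1, h2, h3⟩ := hx z rfl
    rw [accountedMult_coe, rootMultiplicity_eq_zero_of_eval_ne h1,
      rootMultiplicity_eq_zero_of_eval_ne h2, rootMultiplicity_eq_zero_of_eval_ne h3]
    simp

open scoped Classical in
lemma otherCount_eq_sum (hd : 2 ≤ p.natDegree)
    (hs : ∀ α : ℂ, p.eval α = 0 → p.rootMultiplicity α = 1) (hδ : δ ≠ 0) :
    otherCount p δ = ∑ x ∈ supportSet p δ with x ∈ otherPoints p,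
      (critMult (traub p δ) x - accountedMult p δ x) := by
  rw [otherCount, finsum_mem_def,
    finsum_eq_sum_of_support_subset (s := supportSet p δ), Finset.sum_filter]
  · refine Finset.sum_congr rfl fun x _ ↦ ?_
    by_cases hx : x ∈ otherPoints p
    · rw [Set.indicator_of_mem hx, if_pos hx, accountedMult_of_mem_otherPoints hx, Nat.sub_zero]
    · rw [Set.indicator_of_notMem hx, if_neg hx]
  · intro x hx
    refine mem_supportSet_of_critMult_ne_zero hd hs hδ fun h ↦ hx ?_
    rw [Set.indicator_apply, h, ite_self]

/-- The defect `n` is the total excess at the zeros of `p`, `p'`, `p''`; as a sum of natural numbers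
it vanishes only termwise. -/
lemma otherCount_add (hd : 2 ≤ p.natDegree)
    (hs : ∀ α : ℂ, p.eval α = 0 → p.rootMultiplicity α = 1) (hδ : δ ≠ 0) :
    ∃ n, otherCount p δ + n = remainingCount p δ ∧
      (n = 0 ↔ ∀ x ∉ otherPoints p, critMult (traub p δ) x - accountedMult p δ x = 0) := by
  classical
  refine ⟨∑ x ∈ supportSet p δ with x ∉ otherPoints p,
    (critMult (traub p δ) x - accountedMult p δ x), ?_, ?_⟩
  · rw [otherCount_eq_sum hd hs hδ, remainingCount_eq_sum hd hs hδ,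
      Finset.sum_filter_add_sum_filter_not]
  · simp only [Finset.sum_eq_zero_iff, Finset.mem_filter]
    refine ⟨fun h x hx ↦ ?_, fun h x hx ↦ h x hx.2⟩
    by_cases h0 : critMult (traub p δ) x = 0
    · rw [h0, Nat.zero_sub]
    · exact h x ⟨mem_supportSet_of_critMult_ne_zero hd hs hδ h0, hx⟩

lemma rootMultiplicity_critPoly_eq_zero_iff (hd : 2 ≤ p.natDegree)
    (hs : ∀ α : ℂ, p.eval α = 0 → p.rootMultiplicity α = 1) (hδ : δ ≠ 0) {z : ℂ}
    (hz : (derivative p).eval z ≠ 0) :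
    (critPoly p δ).rootMultiplicity z = 0 ↔ bracket p δ z ≠ 0 := by
  rw [rootMultiplicity_eq_zero_iff, IsRoot.def, eval_critPoly hd δ hz, mul_eq_zero,
    or_iff_right (pow_ne_zero _ hz)]
  have := critPoly_ne_zero hd hs hδ
  tauto

/-- The excess is zero at zeros of `p'`. At a zero of `p` it is `ord p''` if `δ = 1` and zero
otherwise. At the remaining zeros of `p''` it is `ord critPoly`, governed by the bracket. -/
lemma forall_not_mem_otherPoints_iff (hd : 2 ≤ p.natDegree)
    (hs : ∀ α : ℂ, p.eval α = 0 → p.rootMultiplicity α = 1) (hδ : δ ≠ 0) :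
    (∀ x ∉ otherPoints p, critMult (traub p δ) x - accountedMult p δ x = 0) ↔
      ∀ γ : ℂ, (derivative (derivative p)).eval γ = 0 → (derivative p).eval γ ≠ 0 →
        (p.eval γ = 0 → δ ≠ 1) ∧ (p.eval γ ≠ 0 → bracket p δ γ ≠ 0) := by
  have hqq := derivative_derivative_ne_zero hd
  constructor
  · intro h γ h1 h2
    have h3 := h (γ : OnePoint ℂ) (fun hm ↦ (hm γ rfl).2.2 h1)
    rw [critMult_sub_accountedMult_coe hd hs hδ] at h3
    constructor
    · rintro h4 h5
      rw [if_pos h5, (rootMultiplicity_critPoly_of_root hd hs hδ h4).2 h5, hs γ h4] at h3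
      have := rootMultiplicity_pos_of_eval_eq hqq h1
      omega
    · intro h4
      rw [rootMultiplicity_eq_zero_of_eval_ne h4, mul_zero, Nat.sub_zero] at h3
      exact (rootMultiplicity_critPoly_eq_zero_iff hd hs hδ h2).1 h3
  · intro h x hx
    induction x using OnePoint.rec with
    -- Infinity satisfies the condition of `otherPoints` vacuously.
    | infty => exact absurd (fun z hz ↦ absurd hz (OnePoint.infty_ne_coe z)) hx
    | coe z =>
      rw [critMult_sub_accountedMult_coe hd hs hδ]
      by_cases h2 : (derivative p).eval z = 0
      · rw [rootMultiplicity_eq_zero_of_eval_ne (critPoly_eval_ne_zero hd hs hδ h2), Nat.zero_sub]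
      by_cases h3 : p.eval z = 0
      · obtain ⟨h4, h5⟩ := rootMultiplicity_critPoly_of_root hd hs hδ h3
        rw [hs z h3]
        split_ifs with h6
        · have h7 : (derivative (derivative p)).eval z ≠ 0 := fun h7 ↦ (h z h7 h2).1 h3 h6
          rw [h5 h6, rootMultiplicity_eq_zero_of_eval_ne h7]
        · rw [h4 h6]
      · have h7 : (derivative (derivative p)).eval z = 0 := by
          by_contra h7
          refine hx fun w hw ↦ ?_
          rw [← OnePoint.coe_injective hw]
          exact ⟨h3, h2, h7⟩
        rw [(rootMultiplicity_critPoly_eq_zero_iff hd hs hδ h2).2 ((h z h7 h2).2 h3), Nat.zero_sub]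

lemma isCritical_iff (f : RatFunc ℂ) (x : OnePoint ℂ) : IsCritical f x ↔ 1 ≤ critMult f x := by
  rw [IsCritical, critMult]
  omega

end DampedTraub

end

theorem mainTheorem7 (d : ℕ) (hd : 2 ≤ d) (p : ℂ[X]) (hp : p.natDegree = d)
    (hsimple : ∀ α : ℂ, p.eval α = 0 → p.rootMultiplicity α = 1) (δ : ℂ) (hδ : δ ≠ 0) :
    -- the degree of the map
    (DampedTraub.degree (DampedTraub.traub p δ) =
      if δ = DampedTraub.degenerateParam d then d ^ 2 - 1 else d ^ 2) ∧
    {x | DampedTraub.IsCritical (DampedTraub.traub p δ) x}.Finite ∧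
    -- (a) the zeros of `p`
    (∀ α : ℂ, p.eval α = 0 →
      DampedTraub.IsCritical (DampedTraub.traub p δ) α ∧
      (δ ≠ 1 → DampedTraub.critMult (DampedTraub.traub p δ) α =
        1 + (derivative (derivative p)).rootMultiplicity α) ∧
      (δ = 1 → DampedTraub.critMult (DampedTraub.traub p δ) α =
        2 * (1 + (derivative (derivative p)).rootMultiplicity α))) ∧
    -- (b) the zeros of `p'`
    (∀ β : ℂ, (derivative p).eval β = 0 →
      DampedTraub.value (DampedTraub.traub p δ) β = OnePoint.infty ∧
      DampedTraub.IsCritical (DampedTraub.traub p δ) β ∧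
      DampedTraub.critMult (DampedTraub.traub p δ) β =
        d * (derivative p).rootMultiplicity β
          + (derivative (derivative p)).rootMultiplicity β) ∧
    -- (c) the zeros of `p''`
    (∀ γ : ℂ, (derivative (derivative p)).eval γ = 0 →
      DampedTraub.IsCritical (DampedTraub.traub p δ) γ ∧
      (derivative (derivative p)).rootMultiplicity γ ≤
        DampedTraub.critMult (DampedTraub.traub p δ) γ ∧
      (p.eval γ ≠ 0 → (derivative p).eval γ ≠ 0 →
        (DampedTraub.critMult (DampedTraub.traub p δ) γ =
            (derivative (derivative p)).rootMultiplicity γ ↔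
          DampedTraub.bracket p δ γ ≠ 0))) ∧
    -- (d) the remaining critical points
    (∀ x : OnePoint ℂ,
      DampedTraub.accountedMult p δ x ≤ DampedTraub.critMult (DampedTraub.traub p δ) x) ∧
    (δ ≠ 1 → δ ≠ DampedTraub.degenerateParam d →
      DampedTraub.remainingCount p δ = d * (d - 1)) ∧
    (δ = 1 → DampedTraub.remainingCount p δ = d * (d - 2)) ∧
    (δ = DampedTraub.degenerateParam d →
      DampedTraub.remainingCount p δ = d * (d - 1) - 2) ∧
    DampedTraub.otherCount p δ ≤ DampedTraub.remainingCount p δ ∧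
    (DampedTraub.otherCount p δ = DampedTraub.remainingCount p δ ↔
      ∀ γ : ℂ, (derivative (derivative p)).eval γ = 0 → (derivative p).eval γ ≠ 0 →
        (p.eval γ = 0 → δ ≠ 1) ∧ (p.eval γ ≠ 0 → DampedTraub.bracket p δ γ ≠ 0)) := by
  subst hp
  obtain ⟨k, hk⟩ : ∃ k, p.natDegree = k + 1 := ⟨p.natDegree - 1, by omega⟩
  have hk1 : 1 ≤ k := by omega
  have hq := DampedTraub.derivative_ne_zero hd
  have hqq := DampedTraub.derivative_derivative_ne_zero hd
  have hcrit := DampedTraub.critMult_traub hd hsimple hδ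
  have hcount := DampedTraub.remainingCount_add hd hsimple hδ
  have hdeg := DampedTraub.degeneracy_eq_zero_iff (δ := δ) hk1
  have hne := DampedTraub.degenerateParam_ne_one hd
  have hsq : (k + 1) * (k + 1) = (k + 1) * k + (k + 1) := by ring
  rw [← hk] at hdeg
  refine ⟨?_, ?_, ?_, ?_, ?_, DampedTraub.accountedMult_le_critMult hd hsimple hδ, ?_, ?_, ?_,
    ?_, ?_⟩
  · rw [hk]
    exact DampedTraub.degree_traub hk hk1 hsimple hδ
  · refine (DampedTraub.supportSet p δ).finite_toSet.subset fun x hx ↦ ?_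
    refine DampedTraub.mem_supportSet_of_critMult_ne_zero hd hsimple hδ ?_
    have := (DampedTraub.isCritical_iff _ _).1 hx
    omega
  · intro α hα
    obtain ⟨h1, h2⟩ := DampedTraub.rootMultiplicity_critPoly_of_root hd hsimple hδ hα
    rw [DampedTraub.isCritical_iff, hcrit,
      DampedTraub.derivative_rootMultiplicity_of_root_eq_zero hd hsimple hα, mul_zero, zero_add]
    refine ⟨?_, fun h ↦ ?_, fun h ↦ ?_⟩
    · by_cases h : δ = 1
      · rw [h2 h]; omega
      · rw [h1 h]; omega
    · rw [h1 h]; omega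
    · rw [h2 h]; omega
  · intro β hβ
    have h1 := DampedTraub.rootMultiplicity_pos_of_eval_eq hq hβ
    rw [DampedTraub.isCritical_iff, hcrit, DampedTraub.rootMultiplicity_eq_zero_of_eval_ne
      (DampedTraub.critPoly_eval_ne_zero hd hsimple hδ hβ), add_zero]
    refine ⟨DampedTraub.value_traub_of_derivative hd hsimple hδ hβ, ?_, rfl⟩
    have : 1 ≤ p.natDegree * (derivative p).rootMultiplicity β := Nat.mul_pos (by omega) h1
    omega
  · intro γ hγ
    have h1 := DampedTraub.rootMultiplicity_pos_of_eval_eq hqq hγ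
    rw [DampedTraub.isCritical_iff, hcrit]
    refine ⟨by omega, by omega, fun _ h3 ↦ ?_⟩
    rw [← DampedTraub.rootMultiplicity_critPoly_eq_zero_iff hd hsimple hδ h3,
      DampedTraub.rootMultiplicity_eq_zero_of_eval_ne h3]
    omega
  · intro h1 h2
    have h3 : DampedTraub.degeneracy k δ ≠ 0 := fun h ↦ h2 (hdeg.1 h)
    rw [DampedTraub.critMult_traub_infty_of_ne hk hk1 hsimple hδ h3, if_neg h1,
      DampedTraub.natDegree_critPoly_of_ne hk h3, hk] at hcount
    rw [hk, Nat.add_sub_cancel]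
    omega
  · intro h1
    have h3 : DampedTraub.degeneracy k δ ≠ 0 := fun h ↦ hne ((hdeg.1 h).symm.trans h1)
    rw [DampedTraub.critMult_traub_infty_of_ne hk hk1 hsimple hδ h3, if_pos h1,
      DampedTraub.natDegree_critPoly_of_ne hk h3, hk] at hcount
    obtain ⟨j, rfl⟩ : ∃ j, k = j + 1 := ⟨k - 1, by omega⟩
    have h4 : (j + 1 + 1) * (j + 1 + 1) = (j + 1 + 1) * j + 2 * (j + 1 + 1) := by ring
    rw [hk, show j + 1 + 1 - 2 = j by omega]
    omega
  · intro h1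
    have h2 : δ ≠ 1 := h1 ▸ hne
    have h3 := DampedTraub.critMult_traub_infty_of_eq hk hk1 hsimple hδ (hdeg.2 h1)
    rw [if_neg h2, hk] at hcount
    rw [hk, Nat.add_sub_cancel]
    omega
  · obtain ⟨n, h1, -⟩ := DampedTraub.otherCount_add hd hsimple hδ
    omega
  · obtain ⟨n, h1, h2⟩ := DampedTraub.otherCount_add hd hsimple hδ
    rw [← DampedTraub.forall_not_mem_otherPoints_iff hd hsimple hδ, ← h2]
    omega
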